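/- Let $I$ be a dense linear order with a least element $0$ and no greatest element. Let $W(I)$ be the first-order structure whose universe is the set of all finite subsets of $I$, in the signature $\{\cup,\cap,\bot,\mathbf{0},\min,\max,\mathrm{ips}\}$, where: $\cup$ and $\cap$ are binary function symbols interpreted as union and intersection; $\bot$ and $\mathbf{0}$ are constants interpreted as $\emptyset$ and $\{0\}$; $\min$ and $\max$ are unary function symbols which send a nonempty finite set $A$ to $\{\min A\}$ and $\{\max A\}$ respectively, and $\emptyset$ to $\emptyset$; and $\mathrm{ips}$ is a binary function symbol interpreted by $$\mathrm{ips}(A,B)=\{i\in A : i \text{ is not the greatest element of } A \text{ and the immediate successor of } i \text{ in } A \text{ belongs to } B\}.$$ Then $W(I)$ is positive-model-complete in this signature: for every $n \ge 0$ and every first-order formula $\varphi(X_1,\dots,X_n)$ of the signature there is a positive existential formula $\psi(X_1,\dots,X_n)$ (one built from atomic formulas using only $\wedge$, $\vee$ and $\exists$) such that $W(I)\models \forall X_1\cdots\forall X_n\,(\varphi\leftrightarrow\psi)$. -/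

import Mathlib

/-- The function symbols of the signature of `W(I)`: two constants (the empty set and the
singleton of the left endpoint), the unary symbols `min` and `max`, and the binary symbols
`∪`, `∩` and `ips`. -/
inductive WIFunc : ℕ → Type
  | union : WIFunc 2
  | inter : WIFunc 2
  | empty : WIFunc 0
  | zero : WIFunc 0
  | min : WIFunc 1
  | max : WIFunc 1
  | ips : WIFunc 2

/-- The signature of `W(I)`; it has no relation symbols besides equality. -/
def langWI : FirstOrder.Language.{0, 0} := ⟨WIFunc, fun _ => Empty⟩

namespace WI

variable {I : Type*} [LinearOrder I]

/-- `j` is the successor of `i` in the finite linear order `A`. -/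
def IsSuccIn (A : Finset I) (i j : I) : Prop :=
  i ∈ A ∧ j ∈ A ∧ i < j ∧ ∀ k ∈ A, i < k → j ≤ k

open Classical in
/-- `ips A B` is the set of all `i ∈ A` whose successor in `A` exists and lies in `B`. -/
noncomputable def ips (A B : Finset I) : Finset I :=
  A.filter fun i => ∃ j ∈ B, IsSuccIn A i j

/-- The singleton of the least element of a nonempty set; the empty set is fixed. -/
def minSet (A : Finset I) : Finset I :=
  if h : A.Nonempty then {A.min' h} else ∅

/-- The singleton of the greatest element of a nonempty set; the empty set is fixed. -/
def maxSet (A : Finset I) : Finset I :=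
  if h : A.Nonempty then {A.max' h} else ∅

/-- The structure `W(I)`, whose universe is the set of finite subsets of `I`.
The left endpoint of `I` is `⊥ : I`. -/
noncomputable instance structureWI [OrderBot I] : langWI.Structure (Finset I) where
  funMap {_} f :=
    match f with
    | WIFunc.union => fun x => x 0 ∪ x 1
    | WIFunc.inter => fun x => x 0 ∩ x 1
    | WIFunc.empty => fun _ => ∅
    | WIFunc.zero => fun _ => {⊥}
    | WIFunc.min => fun x => minSet (x 0)
    | WIFunc.max => fun x => maxSet (x 0)
    | WIFunc.ips => fun x => ips (x 0) (x 1)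
  RelMap {_} r := r.elim

end WI

/-- Positive existential formulas: those built from atomic formulas by conjunction, disjunction
and existential quantification. -/
inductive IsPositiveExistential {L : FirstOrder.Language} {α : Type*} :
    ∀ {n : ℕ}, L.BoundedFormula α n → Prop
  | of_isAtomic {n : ℕ} {φ : L.BoundedFormula α n} (h : φ.IsAtomic) : IsPositiveExistential φ
  | inf {n : ℕ} {φ ψ : L.BoundedFormula α n} (hφ : IsPositiveExistential φ)
      (hψ : IsPositiveExistential ψ) : IsPositiveExistential (φ ⊓ ψ)
  | sup {n : ℕ} {φ ψ : L.BoundedFormula α n} (hφ : IsPositiveExistential φ)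
      (hψ : IsPositiveExistential ψ) : IsPositiveExistential (φ ⊔ ψ)
  | ex {n : ℕ} {φ : L.BoundedFormula α (n + 1)} (h : IsPositiveExistential φ) :
      IsPositiveExistential φ.ex

/-- An `L`-structure `M` is positive-model-complete if every first-order `L`-formula is equivalent
in `M` to a positive existential `L`-formula in the same free variables. -/
def PositiveModelComplete (L : FirstOrder.Language) (M : Type*) [L.Structure M] : Prop :=
  ∀ (n : ℕ) (φ : L.Formula (Fin n)), ∃ ψ : L.Formula (Fin n),
    IsPositiveExistential ψ ∧ ∀ v : Fin n → M, φ.Realize v ↔ ψ.Realize v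

/-!
The structure `W(I)` carries the weak monadic second-order theory of the order `I`, and the proof
follows Büchi's translation between formulas and finite automata.

A tuple `v` of finite subsets of `I` is coded by words: enumerate increasingly a finite set that
contains `⊥` and all entries of `v`, and read at each point the set of the indices `k` with
`x ∈ v k`. A relation is `Recognizable` if a regular language decides it from any such word.
Recognizable relations are closed under Boolean operations, because regular languages are, and
under projection (`Recognizable.ex`): the subset automaton guesses the letters of the forgotten set,
inserting new points where needed. Such points exist because `I` is dense without a greatest
element, and none lies below `⊥`. Inclusion and the relation `∃ x ∈ X, ∃ y ∈ Y, x < y` are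
recognizable, and the graphs of all function symbols are first-order definable from them. Hence
every formula defines a recognizable relation (`Recognizable.boundedFormula`).

Conversely, acceptance by an automaton is a positive existential condition
(`Recognizable.posEx`): it says that there is a finite partition `P (q, a)` of a finite set, where
`P (q, a)` holds the points at which the automaton is in state `q` and reads `a`, such that the
transitions are respected. Respecting the transitions means that each `P (q, a)` is contained in the
union of the maximum and of the set of points whose successor lies in some `P (δ(q, a), b)`, which
is an inclusion between terms in `ips` and `max`. No negation occurs, since the complement of a
color class is the union of the other classes.
-/

namespace WI

/-! ### Recognizable relations -/

section Automata

variable {I : Type*} {α β : Type}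

/-- The letter at the point `x` of the word coding a tuple `v` of finite sets: the set of the
indices `k` with `x ∈ v k`. -/
def letter (v : α → Finset I) (x : I) : Set α := {k | x ∈ v k}

@[simp] theorem mem_letter {v : α → Finset I} {x : I} {k : α} : k ∈ letter v x ↔ x ∈ v k := Iff.rfl

/-- `⊥ :: l` is the increasing enumeration of a finite set that contains every entry of the
tuple `v`. -/
structure Covers [LinearOrder I] [OrderBot I] (v : α → Finset I) (l : List I) : Prop where
  sorted : (⊥ :: l).Pairwise (· < ·)
  mem : ∀ k, ∀ x ∈ v k, x ∈ ⊥ :: l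

/-- A relation between finite subsets of `I` is recognizable if some regular language decides it
from the word of letters read along any increasing list that starts with `⊥` and covers the tuple.
Points of the list outside the tuple contribute the empty letter, and the language has to give
the same answer however many of them there are. -/
def Recognizable [LinearOrder I] [OrderBot I] (R : (α → Finset I) → Prop) : Prop :=
  ∃ L : Language (Set α), L.IsRegular ∧
    ∀ v l, Covers v l → (R v ↔ (⊥ :: l).map (letter v) ∈ L)

/-- The subset automaton of the projection that forgets the coordinate `none`. After each letter
it may insert any number of letters `{none}`, which stand for points of the forgotten set outside
the remaining tuple. Nothing is inserted before the first letter, since nothing lies below `⊥`. -/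
def projDFA {σ : Type} (M : DFA (Set (Option α)) σ) : DFA (Set α) (Set σ) where
  step T a := {q | ∃ p ∈ T, ∃ b : Set (Option α), some ⁻¹' b = a ∧
    ∃ n : ℕ, M.evalFrom (M.step p b) (List.replicate n {none}) = q}
  start := {M.start}
  accept := {T | ∃ q ∈ T, q ∈ M.accept}

/-- A run of `M` along a list projects to a run along the sublist of the points in `S`, provided the
other points carry the letter `{none}`. -/
theorem evalFrom_mem_projDFA {σ : Type} (M : DFA (Set (Option α)) σ) (v : α → Finset I)
    (X : Finset I) (S : Set I) [DecidablePred (· ∈ S)] (l : List I)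
    (hl : ∀ x ∈ l, x ∉ S → letter (fun o : Option α => o.elim X v) x = {none})
    (T : Set σ) (hT : ∀ p ∈ T, M.step p {none} ∈ T) (p : σ) (hp : p ∈ T) :
    M.evalFrom p (l.map (letter fun o : Option α => o.elim X v)) ∈
      (projDFA M).evalFrom T ((l.filter (· ∈ S)).map (letter v)) := by
  induction l generalizing T p with
  | nil => exact hp
  | cons x t ih =>
    have ht := fun y hy => hl y (List.mem_cons_of_mem x hy)
    by_cases hx : x ∈ S
    · simp only [hx, decide_true, List.filter_cons_of_pos, List.map_cons, DFA.evalFrom_cons]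
      refine ih ht _ ?_ _ ⟨p, hp, _, rfl, 0, rfl⟩
      rintro _ ⟨p, hp, b, hb, n, rfl⟩
      exact ⟨p, hp, b, hb, n + 1, by simp [List.replicate_succ']⟩
    · simp only [hx, decide_false, Bool.false_eq_true, not_false_eq_true,
        List.filter_cons_of_neg, List.map_cons, DFA.evalFrom_cons, hl x (by simp) hx]
      exact ih ht T hT _ (hT p hp)

variable [LinearOrder I]

theorem exists_sorted_list_between [DenselyOrdered I] {x u : I} (h : x < u) (n : ℕ) :
    ∃ l : List I, l.length = n ∧ l.Pairwise (· < ·) ∧ ∀ y ∈ l, x < y ∧ y < u := by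
  induction n generalizing x with
  | zero => exact ⟨[], by simp⟩
  | succ n ih =>
    obtain ⟨y, hxy, hyu⟩ := exists_between h
    obtain ⟨l, hl, hs, hb⟩ := ih hyu
    refine ⟨y :: l, by simp [hl], List.pairwise_cons.2 ⟨fun z hz => (hb z hz).1, hs⟩, ?_⟩
    simp only [List.mem_cons, forall_eq_or_imp]
    exact ⟨⟨hxy, hyu⟩, fun z hz => ⟨hxy.trans (hb z hz).1, (hb z hz).2⟩⟩

/-- Every run of the projected automaton along `l` comes from a run of `M` along a longer increasing
list: density and the absence of a greatest element leave room for the inserted letters. -/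
theorem exists_run_of_mem_projDFA [DenselyOrdered I] [NoMaxOrder I] {σ : Type}
    (M : DFA (Set (Option α)) σ) (v : α → Finset I) {q : σ} (l : List I) (T : Set σ)
    (hl : l.Pairwise (· < ·)) (hv : ∀ k, ∀ y ∈ v k, (∃ z ∈ l, z ≤ y) → y ∈ l)
    (hq : q ∈ (projDFA M).evalFrom T (l.map (letter v))) :
    ∃ p ∈ T, ∃ w : List (I × Set (Option α)), (w.map Prod.fst).Pairwise (· < ·) ∧
      (∀ c ∈ w, ∃ z ∈ l, z ≤ c.1) ∧ (∀ c ∈ w, some ⁻¹' c.2 = letter v c.1) ∧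
      (∀ z ∈ l, z ∈ w.map Prod.fst) ∧ M.evalFrom p (w.map Prod.snd) = q := by
  induction l generalizing T with
  | nil => exact ⟨q, hq, [], by simp⟩
  | cons x t ih =>
    rw [List.pairwise_cons] at hl
    obtain ⟨p', hp', w, hws, hwl, hwv, hlw, hwq⟩ := ih _ hl.2 (by
      rintro k y hy ⟨z, hz, hzy⟩
      have := hv k y hy ⟨z, List.mem_cons_of_mem _ hz, hzy⟩
      rcases List.mem_cons.1 this with rfl | h
      · exact absurd (hl.1 z hz) hzy.not_gt
      · exact h) hq
    obtain ⟨p, hp, b, hb, n, hn⟩ := hp'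
    obtain ⟨u, hxu, hu⟩ : ∃ u, x < u ∧ ∀ z ∈ t, u ≤ z := by
      cases t with
      | nil => exact (exists_gt x).imp fun u hu => ⟨hu, by simp⟩
      | cons y t =>
        refine ⟨y, hl.1 y (by simp), ?_⟩
        have := (List.pairwise_cons.1 hl.2).1
        simp only [List.mem_cons, forall_eq_or_imp, le_refl, true_and]
        exact fun z hz => (this z hz).le
    obtain ⟨m, hmn, hms, hm⟩ := exists_sorted_list_between hxu n
    have huw : ∀ c ∈ w, u ≤ c.1 := fun c hc => by
      obtain ⟨z, hz, hzc⟩ := hwl c hc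
      exact (hu z hz).trans hzc
    refine ⟨p, hp, (x, b) :: (m.map (fun y => (y, {none})) ++ w), ?_, ?_, ?_, ?_, ?_⟩
    · simp only [List.map_cons, List.map_append, List.map_map, Function.comp_def, List.map_id',
        List.pairwise_cons, List.pairwise_append, List.mem_append]
      refine ⟨?_, hms, hws, ?_⟩
      · rintro y (hy | hy)
        · exact (hm y hy).1
        · obtain ⟨c, hc, rfl⟩ := List.mem_map.1 hy
          exact hxu.trans_le (huw c hc)
      · intro y hy z hz
        obtain ⟨c, hc, rfl⟩ := List.mem_map.1 hz
        exact (hm y hy).2.trans_le (huw c hc)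
    · simp only [List.mem_cons, List.mem_append, List.mem_map]
      rintro c (rfl | ⟨y, hy, rfl⟩ | hc)
      · exact ⟨x, by simp, le_rfl⟩
      · exact ⟨x, by simp, (hm y hy).1.le⟩
      · obtain ⟨z, hz, hzc⟩ := hwl c hc
        exact ⟨z, Or.inr hz, hzc⟩
    · simp only [List.mem_cons, List.mem_append, List.mem_map]
      rintro c (rfl | ⟨y, hy, rfl⟩ | hc)
      · exact hb
      · ext k
        simp only [Set.mem_preimage, Set.mem_singleton_iff, reduceCtorEq, mem_letter, false_iff]
        intro hk
        rcases List.mem_cons.1 (hv k y hk ⟨x, by simp, (hm y hy).1.le⟩) with rfl | h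
        · exact (hm y hy).1.false
        · exact ((hm y hy).2.trans_le (hu y h)).false
      · exact hwv c hc
    · simp only [List.mem_cons, List.map_cons, List.map_append]
      rintro z (rfl | hz)
      · exact Or.inl rfl
      · exact Or.inr (List.mem_append_right _ (hlw z hz))
    · simp only [List.map_cons, List.map_append, List.map_map, Function.comp_def,
        DFA.evalFrom_cons, DFA.evalFrom_of_append, List.map_const', hmn, hn, hwq]

variable [OrderBot I]

/-- The point `⊥` is always listed first, whether or not it belongs to `S`. -/
theorem Covers.exists (v : α → Finset I) (S : Finset I) (h : ∀ k, v k ⊆ S) :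
    ∃ l, Covers v l ∧ ∀ x, x ∈ ⊥ :: l ↔ x = ⊥ ∨ x ∈ S := by
  have hmem : ∀ x, x ∈ ⊥ :: (S.erase ⊥).sort (· ≤ ·) ↔ x = ⊥ ∨ x ∈ S := fun x => by
    by_cases hx : x = ⊥ <;> simp [hx]
  refine ⟨(S.erase ⊥).sort (· ≤ ·), ⟨?_, fun k x hx => (hmem x).2 (Or.inr (h k hx))⟩, hmem⟩
  refine List.pairwise_cons.2 ⟨fun x hx => ?_, (Finset.sortedLT_sort _).pairwise⟩
  simp only [Finset.mem_sort, Finset.mem_erase] at hx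
  exact bot_lt_iff_ne_bot.2 hx.1

/-! ### Closure properties of recognizable relations -/

namespace Recognizable

theorem not {R : (α → Finset I) → Prop} (h : Recognizable R) : Recognizable fun v => ¬ R v := by
  obtain ⟨L, hL, h⟩ := h
  exact ⟨Lᶜ, hL.compl, fun v l hl => not_congr (h v l hl)⟩

theorem and {R S : (α → Finset I) → Prop} (hR : Recognizable R) (hS : Recognizable S) :
    Recognizable fun v => R v ∧ S v := by
  obtain ⟨L, hL, hR⟩ := hR
  obtain ⟨K, hK, hS⟩ := hS
  exact ⟨L ⊓ K, hL.inf hK, fun v l hl => and_congr (hR v l hl) (hS v l hl)⟩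

theorem congr {R S : (α → Finset I) → Prop} (hR : Recognizable R) (h : ∀ v, S v ↔ R v) :
    Recognizable S := by
  rwa [show S = R from funext fun v => propext (h v)]

theorem imp {R S : (α → Finset I) → Prop} (hR : Recognizable R) (hS : Recognizable S) :
    Recognizable fun v => R v → S v :=
  (hR.and hS.not).not.congr fun v => by tauto

theorem or {R S : (α → Finset I) → Prop} (hR : Recognizable R) (hS : Recognizable S) :
    Recognizable fun v => R v ∨ S v :=
  (hR.not.and hS.not).not.congr fun v => by tauto

theorem iff {R S : (α → Finset I) → Prop} (hR : Recognizable R) (hS : Recognizable S) :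
    Recognizable fun v => R v ↔ S v :=
  ((hR.imp hS).and (hS.imp hR)).congr fun v => by tauto

theorem reindex {R : (α → Finset I) → Prop} (hR : Recognizable R) (f : α → β) :
    Recognizable fun v : β → Finset I => R fun a => v (f a) := by
  obtain ⟨L, ⟨σ, hσ, M, rfl⟩, hR⟩ := hR
  refine ⟨_, ⟨σ, hσ, M.comap (f ⁻¹' ·), rfl⟩, fun v l hl => ?_⟩
  refine (hR (fun a => v (f a)) l ⟨hl.sorted, fun k => hl.mem (f k)⟩).trans ?_
  rw [DFA.accepts_comap]
  change _ ↔ List.map _ _ ∈ M.accepts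
  rw [List.map_map]
  rfl

/-- Projection of recognizable relations, with `projDFA` as the automaton. -/
theorem ex [DenselyOrdered I] [NoMaxOrder I] {R : (α → Finset I) → Finset I → Prop}
    (hR : Recognizable fun v : Option α → Finset I => R (fun a => v (some a)) (v none)) :
    Recognizable fun v => ∃ X, R v X := by
  classical
  obtain ⟨L, ⟨σ, hσ, M, rfl⟩, hR⟩ := hR
  refine ⟨_, ⟨Set σ, inferInstance, projDFA M, rfl⟩, fun v l hl => ⟨?_, ?_⟩⟩
  · rintro ⟨X, hX⟩
    set S : Set I := {x | x ∈ ⊥ :: l} with hS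
    obtain ⟨l', hl', hmem⟩ := Covers.exists (fun o : Option α => o.elim X v)
      (X ∪ (⊥ :: l).toFinset) (by
        rintro (_ | k)
        · exact Finset.subset_union_left
        · exact fun x hx => Finset.mem_union_right _ (List.mem_toFinset.2 (hl.mem k x hx)))
    have hacc := (hR _ l' hl').1 hX
    -- `⊥ :: l` is the sublist of `⊥ :: l'` from which the inserted points have been removed.
    have hfilter : (⊥ :: l').filter (· ∈ S) = ⊥ :: l := by
      refine List.Pairwise.eq_of_mem_iff (hl'.sorted.filter _) hl.sorted fun x => ?_
      simp only [List.mem_filter, hmem, hS, decide_eq_true_eq, Set.mem_ofPred_eq]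
      refine ⟨fun h => h.2, fun h => ⟨Or.inr (Finset.mem_union_right _ ?_), h⟩⟩
      exact List.mem_toFinset.2 h
    have hbot : (⊥ : I) ∈ S := by simp [hS]
    rw [List.filter_cons_of_pos (by simpa using hbot)] at hfilter
    replace hfilter := (List.cons.inj hfilter).2
    refine ⟨_, ?_, hacc⟩
    rw [← hfilter]
    rw [List.map_cons, List.map_cons, DFA.evalFrom_cons]
    refine evalFrom_mem_projDFA M v X S l' ?_ _ ?_ _ ⟨_, rfl, _, rfl, 0, rfl⟩
    · intro x hx hxS
      have hxX : x ∈ X := by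
        have := (hmem x).1 (List.mem_cons_of_mem _ hx)
        simp only [Finset.mem_union, List.mem_toFinset] at this
        rcases this with rfl | h | h
        · exact absurd hbot hxS
        · exact h
        · exact absurd h hxS
      ext (_ | k)
      · simpa using hxX
      · simpa using fun h => hxS (hl.mem k x h)
    · rintro _ ⟨p, hp, b, hb, n, rfl⟩
      exact ⟨p, hp, b, hb, n + 1, by simp [List.replicate_succ']⟩
  · rintro ⟨q, hq, hacc⟩
    obtain ⟨p, rfl, w, hws, -, hwv, hlw, rfl⟩ := exists_run_of_mem_projDFA M v (⊥ :: l) _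
      hl.sorted (fun k y hy _ => hl.mem k y hy) hq
    -- The witness consists of the points of the longer list whose letter contains `none`.
    set X : Finset I := ((w.filter fun c => none ∈ c.2).map Prod.fst).toFinset with hX
    have hinj := List.inj_on_of_nodup_map (hws.imp fun h => ne_of_lt h)
    have hletter : ∀ c ∈ w, letter (fun o : Option α => o.elim X v) c.1 = c.2 := by
      intro c hc
      ext (_ | k)
      · simp only [mem_letter, Option.elim_none, hX, List.mem_toFinset, List.mem_map,
          List.mem_filter, decide_eq_true_eq]
        refine ⟨?_, fun h => ⟨c, ⟨hc, h⟩, rfl⟩⟩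
        rintro ⟨d, ⟨hd, hdn⟩, hdc⟩
        rwa [← hinj hd hc hdc]
      · exact (Set.ext_iff.1 (hwv c hc) k).symm
    obtain ⟨l', hl'⟩ : ∃ l', w.map Prod.fst = ⊥ :: l' := by
      have hb := hlw ⊥ (by simp)
      cases hw : w.map Prod.fst with
      | nil => simp [hw] at hb
      | cons a t =>
        rw [hw] at hb hws
        rcases List.mem_cons.1 hb with rfl | h
        · exact ⟨t, rfl⟩
        · exact absurd ((List.pairwise_cons.1 hws).1 _ h) not_lt_bot
    have hcov : Covers (fun o : Option α => o.elim X v) l' := by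
      refine ⟨hl' ▸ hws, ?_⟩
      rintro (_ | k) x hx
      · rw [← hl']
        simp only [Option.elim_none, hX, List.mem_toFinset, List.mem_map, List.mem_filter] at hx ⊢
        obtain ⟨c, hc, rfl⟩ := hx
        exact ⟨c, hc.1, rfl⟩
      · exact hl' ▸ hlw x (hl.mem k x hx)
    refine ⟨X, (hR _ l' hcov).2 ?_⟩
    rw [← hl', List.map_map, List.map_congr_left (f := letter _ ∘ Prod.fst) (g := Prod.snd) hletter]
    exact hacc

theorem all [DenselyOrdered I] [NoMaxOrder I] {R : (α → Finset I) → Finset I → Prop}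
    (hR : Recognizable fun v : Option α → Finset I => R (fun a => v (some a)) (v none)) :
    Recognizable fun v => ∀ X, R v X :=
  (ex (R := fun v X => ¬ R v X) hR.not).not.congr fun v => by simp

theorem subset (a b : α) : Recognizable fun v : α → Finset I => v a ⊆ v b := by
  let M : DFA (Set α) Prop := ⟨fun s c => s ∧ (a ∈ c → b ∈ c), True, {s | s}⟩
  have hM : ∀ s w, M.evalFrom s w ↔ s ∧ ∀ c ∈ w, a ∈ c → b ∈ c := fun s w => by
    induction w generalizing s with
    | nil => simp
    | cons c w ih => simp [ih, M, and_assoc]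
  refine ⟨_, ⟨Prop, inferInstance, M, rfl⟩, fun v l hl => ?_⟩
  refine Iff.trans ?_ (hM True _).symm
  simp only [true_and, List.forall_mem_map, mem_letter]
  exact ⟨fun h x _ hx => h hx, fun h x hx => h x (hl.mem a x hx) hx⟩

theorem eq (a b : α) : Recognizable fun v : α → Finset I => v a = v b :=
  ((subset a b).and (subset b a)).congr fun _ => Finset.Subset.antisymm_iff

/-- The automaton keeps track of whether a point of `v a` has been read, and of whether a point of
`v b` has been read after one. -/
theorem exists_lt (a b : α) :
    Recognizable fun v : α → Finset I => ∃ x ∈ v a, ∃ y ∈ v b, x < y := by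
  let M : DFA (Set α) (Prop × Prop) :=
    ⟨fun s c => (s.1 ∨ a ∈ c, s.2 ∨ s.1 ∧ b ∈ c), (False, False), {s | s.2}⟩
  have hM : ∀ (v : α → Finset I) (l : List I), l.Pairwise (· < ·) → ∀ s : Prop × Prop,
      (M.evalFrom s (l.map (letter v))).2 ↔ s.2 ∨ (s.1 ∧ ∃ y ∈ l, y ∈ v b) ∨
        ∃ x ∈ l, x ∈ v a ∧ ∃ y ∈ l, y ∈ v b ∧ x < y := fun v l hl s => by
    induction l generalizing s with
    | nil => simp
    | cons z l ih =>
      rw [List.pairwise_cons] at hl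
      rw [List.map_cons, DFA.evalFrom_cons, ih hl.2]
      simp only [M, mem_letter, List.mem_cons]
      grind
  refine ⟨_, ⟨Prop × Prop, inferInstance, M, rfl⟩, fun v l hl => ?_⟩
  refine Iff.trans ?_ (hM v _ hl.sorted (False, False)).symm
  have := hl.mem a
  have := hl.mem b
  grind

end Recognizable

end Automata

/-! ### First-order formulas define recognizable relations -/

section Formulas

variable {I : Type*} [LinearOrder I] {α β : Type}

theorem mem_minSet {A : Finset I} {x : I} : x ∈ minSet A ↔ x ∈ A ∧ ∀ y ∈ A, x ≤ y := by
  unfold minSet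
  split_ifs with h
  · rw [Finset.mem_singleton]
    refine ⟨?_, fun hx => (Finset.min'_eq_iff A h x).2 hx |>.symm⟩
    rintro rfl
    exact ⟨A.min'_mem h, A.min'_le⟩
  · rw [Finset.not_nonempty_iff_eq_empty] at h
    simp [h]

theorem mem_maxSet {A : Finset I} {x : I} : x ∈ maxSet A ↔ x ∈ A ∧ ∀ y ∈ A, y ≤ x := by
  unfold maxSet
  split_ifs with h
  · rw [Finset.mem_singleton]
    refine ⟨?_, fun hx => (Finset.max'_eq_iff A h x).2 hx |>.symm⟩
    rintro rfl
    exact ⟨A.max'_mem h, A.le_max'⟩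
  · rw [Finset.not_nonempty_iff_eq_empty] at h
    simp [h]

theorem mem_ips {A B : Finset I} {x : I} : x ∈ ips A B ↔ ∃ y ∈ B, IsSuccIn A x y := by
  simp only [ips, Finset.mem_filter, and_iff_right_iff_imp]
  rintro ⟨y, -, h⟩
  exact h.1

variable [OrderBot I] [DenselyOrdered I] [NoMaxOrder I]

namespace Recognizable

/-- The singletons are the atoms of the lattice of finite sets, so inclusion alone defines them. -/
theorem singleton (a : α) : Recognizable fun v : α → Finset I => ∃ x, v a = {x} := by
  have h1 : Recognizable fun v : α → Finset I => ∃ T, ¬ v a ⊆ T :=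
    ex (R := fun v T => ¬ v a ⊆ T) (subset (some a) none).not
  have h2 : Recognizable fun v : α → Finset I =>
      ∀ T, T ⊆ v a → (∀ S, T ⊆ S) ∨ v a ⊆ T :=
    all (R := fun v T => T ⊆ v a → (∀ S, T ⊆ S) ∨ v a ⊆ T)
      ((subset none (some a)).imp
        ((all (R := fun v S => v none ⊆ S) (subset (some none) none)).or (subset (some a) none)))
  refine (h1.and h2).congr fun v => ⟨?_, ?_⟩
  · rintro ⟨x, hx⟩
    rw [hx]
    refine ⟨⟨∅, by simp⟩, fun T hT => ?_⟩
    rcases Finset.subset_singleton_iff.1 hT with rfl | rfl <;> simp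
  · rintro ⟨⟨T, hT⟩, h⟩
    obtain ⟨x, hx, -⟩ := Finset.not_subset.1 hT
    refine ⟨x, ?_⟩
    rcases h {x} (by simpa using hx) with h | h
    · exact absurd (h ∅) (by simp)
    · exact h.antisymm (by simpa using hx)

/-- Quantification over points, each point `x` being represented by the set `{x}`. -/
theorem forall_singleton {R : (α → Finset I) → Finset I → Prop}
    (hR : Recognizable fun v : Option α → Finset I => R (fun a => v (some a)) (v none)) :
    Recognizable fun v => ∀ x, R v {x} :=
  (all (R := fun v X => (∃ x, X = {x}) → R v X) ((singleton none).imp hR)).congr fun v => by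
    simp only [forall_exists_index, forall_eq_apply_imp_iff]

theorem exists_singleton {R : (α → Finset I) → Finset I → Prop}
    (hR : Recognizable fun v : Option α → Finset I => R (fun a => v (some a)) (v none)) :
    Recognizable fun v => ∃ x, R v {x} :=
  (forall_singleton (R := fun v X => ¬ R v X) hR.not).not.congr fun v => by simp

theorem eq_union (a b c : α) : Recognizable fun v : α → Finset I => v a = v b ∪ v c :=
  (forall_singleton (R := fun v X => X ⊆ v a ↔ X ⊆ v b ∨ X ⊆ v c)
    ((subset none (some a)).iff ((subset none (some b)).or (subset none (some c))))).congr
    fun v => by simp [Finset.ext_iff]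

theorem eq_inter (a b c : α) : Recognizable fun v : α → Finset I => v a = v b ∩ v c :=
  (forall_singleton (R := fun v X => X ⊆ v a ↔ X ⊆ v b ∧ X ⊆ v c)
    ((subset none (some a)).iff ((subset none (some b)).and (subset none (some c))))).congr
    fun v => by simp [Finset.ext_iff]

theorem eq_empty (a : α) : Recognizable fun v : α → Finset I => v a = ∅ :=
  (forall_singleton (R := fun v X => ¬ X ⊆ v a) (subset none (some a)).not).congr
    fun v => by simp [Finset.eq_empty_iff_forall_notMem]

/-- The point `⊥` is the only one that has no point below it. -/
theorem eq_bot (a : α) : Recognizable fun v : α → Finset I => v a = {⊥} :=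
  (forall_singleton (R := fun v X => X ⊆ v a ↔ ∀ y, ¬ ∃ x ∈ ({y} : Finset I), ∃ z ∈ X, x < z)
    ((subset none (some a)).iff
      (forall_singleton (R := fun v Y => ¬ ∃ x ∈ Y, ∃ z ∈ v none, x < z)
        (exists_lt none (some none)).not))).congr
    fun v => by
      simp only [Finset.ext_iff, Finset.mem_singleton, Finset.singleton_subset_iff,
        exists_eq_left, not_lt]
      exact forall_congr' fun x => iff_congr Iff.rfl
        ⟨fun h => h ▸ fun _ => bot_le, fun h => le_bot_iff.1 (h ⊥)⟩

theorem eq_minSet (a b : α) : Recognizable fun v : α → Finset I => v a = minSet (v b) :=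
  (forall_singleton (R := fun v X => X ⊆ v a ↔ X ⊆ v b ∧ ¬ ∃ x ∈ v b, ∃ z ∈ X, x < z)
    ((subset none (some a)).iff ((subset none (some b)).and (exists_lt (some b) none).not))).congr
    fun v => by simp [Finset.ext_iff, mem_minSet]

theorem eq_maxSet (a b : α) : Recognizable fun v : α → Finset I => v a = maxSet (v b) :=
  (forall_singleton (R := fun v X => X ⊆ v a ↔ X ⊆ v b ∧ ¬ ∃ x ∈ X, ∃ z ∈ v b, x < z)
    ((subset none (some a)).iff ((subset none (some b)).and (exists_lt none (some b)).not))).congr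
    fun v => by simp [Finset.ext_iff, mem_maxSet]

/-- For `v b = {x}` and `v c = {y}` this relation is `IsSuccIn (v a) x y`. -/
theorem isSuccIn (a b c : α) : Recognizable fun v : α → Finset I =>
    v b ⊆ v a ∧ v c ⊆ v a ∧ (∃ x ∈ v b, ∃ y ∈ v c, x < y) ∧ ∀ k, {k} ⊆ v a →
      (∃ x ∈ v b, ∃ y ∈ ({k} : Finset I), x < y) → ¬ ∃ x ∈ ({k} : Finset I), ∃ y ∈ v c, x < y :=
  (subset b a).and ((subset c a).and ((exists_lt b c).and
    (forall_singleton (R := fun v K => K ⊆ v a → (∃ x ∈ v b, ∃ y ∈ K, x < y) →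
        ¬ ∃ x ∈ K, ∃ y ∈ v c, x < y)
      ((subset none (some a)).imp ((exists_lt (some b) none).imp (exists_lt none (some c)).not)))))

theorem eq_ips (a b c : α) : Recognizable fun v : α → Finset I => v a = ips (v b) (v c) := by
  have h1 := isSuccIn (I := I) (some (some b)) (some none) (none : Option (Option α))
  have h2 := exists_singleton (R := fun v Y => Y ⊆ v (some c) ∧
    (v none ⊆ v (some b) ∧ Y ⊆ v (some b) ∧ (∃ x ∈ v none, ∃ y ∈ Y, x < y) ∧
      ∀ k, {k} ⊆ v (some b) → (∃ x ∈ v none, ∃ y ∈ ({k} : Finset I), x < y) →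
        ¬ ∃ x ∈ ({k} : Finset I), ∃ y ∈ Y, x < y))
    ((subset none (some (some c))).and h1)
  refine (forall_singleton (R := fun v X => X ⊆ v a ↔ ∃ y, {y} ⊆ v c ∧
    (X ⊆ v b ∧ {y} ⊆ v b ∧ (∃ x ∈ X, ∃ z ∈ ({y} : Finset I), x < z) ∧
      ∀ k, {k} ⊆ v b → (∃ x ∈ X, ∃ y ∈ ({k} : Finset I), x < y) →
        ¬ ∃ x ∈ ({k} : Finset I), ∃ z ∈ ({y} : Finset I), x < z))
    ((subset none (some a)).iff h2)).congr fun v => ?_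
  simp [Finset.ext_iff, mem_ips, IsSuccIn]

/-- Composition of graphs: a recognizable function of a recognizable function, with the inner value
quantified existentially. -/
theorem comp₁ {f : Finset I → Finset I} {F : (α → Finset I) → Finset I}
    (hf : ∀ {β : Type} (a b : β), Recognizable fun v : β → Finset I => v a = f (v b))
    (hF : Recognizable fun v : Option α → Finset I => v none = F fun k => v (some k)) :
    Recognizable fun v : Option α → Finset I => v none = f (F fun k => v (some k)) :=
  (ex (R := fun v A => A = F (fun k => v (some k)) ∧ v none = f A)
    ((hF.reindex (Option.elim · none fun k => some (some k))).and (hf (some none) none))).congr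
    fun v => by simp

theorem comp₂ {f : Finset I → Finset I → Finset I} {F G : (α → Finset I) → Finset I}
    (hf : ∀ {β : Type} (a b c : β), Recognizable fun v : β → Finset I => v a = f (v b) (v c))
    (hF : Recognizable fun v : Option α → Finset I => v none = F fun k => v (some k))
    (hG : Recognizable fun v : Option α → Finset I => v none = G fun k => v (some k)) :
    Recognizable fun v : Option α → Finset I =>
      v none = f (F fun k => v (some k)) (G fun k => v (some k)) :=
  (ex (R := fun v A => A = F (fun k => v (some k)) ∧
      ∃ B, B = G (fun k => v (some k)) ∧ v none = f A B)
    ((hF.reindex (Option.elim · none fun k => some (some k))).and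
      (ex (R := fun v B => B = G (fun k => v (some (some k))) ∧ v (some none) = f (v none) B)
        ((hG.reindex (Option.elim · none fun k => some (some (some k)))).and
          (hf (some (some none)) (some none) none))))).congr
    fun v => by simp

/-- The graph of a term, with the value in the coordinate `none`, is recognizable. -/
theorem term (t : langWI.Term α) :
    Recognizable fun v : Option α → Finset I => v none = t.realize fun k => v (some k) := by
  induction t with
  | var k => exact eq none (some k)
  | func f ts ih =>
    cases f with
    | union =>
      exact comp₂ (F := fun v => (ts 0).realize v) (G := fun v => (ts 1).realize v)
        eq_union (ih 0) (ih 1)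
    | inter =>
      exact comp₂ (F := fun v => (ts 0).realize v) (G := fun v => (ts 1).realize v)
        eq_inter (ih 0) (ih 1)
    | empty => exact eq_empty none
    | zero => exact eq_bot none
    | min => exact comp₁ (F := fun v => (ts 0).realize v) eq_minSet (ih 0)
    | max => exact comp₁ (F := fun v => (ts 0).realize v) eq_maxSet (ih 0)
    | ips =>
      exact comp₂ (F := fun v => (ts 0).realize v) (G := fun v => (ts 1).realize v)
        eq_ips (ih 0) (ih 1)

theorem boundedFormula {n : ℕ} (φ : langWI.BoundedFormula α n) :
    Recognizable fun v : α ⊕ Fin n → Finset I =>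
      φ.Realize (fun a => v (Sum.inl a)) (fun i => v (Sum.inr i)) := by
  induction φ with
  | falsum =>
    exact ⟨0, ⟨Unit, inferInstance, ⟨fun _ _ => (), (), ∅⟩, rfl⟩, fun v l _ => Iff.rfl⟩
  | equal t₁ t₂ =>
    refine (ex (R := fun v A => A = t₁.realize v ∧ A = t₂.realize v)
      ((term t₁).and (term t₂))).congr fun v => ?_
    have hv : Sum.elim (fun a => v (Sum.inl a)) (fun i => v (Sum.inr i)) = v :=
      Sum.elim_comp_inl_inr v
    simp [FirstOrder.Language.BoundedFormula.Realize, hv]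
  | rel r => exact r.elim
  | imp φ ψ hφ hψ => exact hφ.imp hψ
  | @all n φ ih =>
    refine all (R := fun v X => φ.Realize (fun a => v (Sum.inl a))
      (Fin.snoc (fun i => v (Sum.inr i)) X)) ?_
    refine (ih.reindex (Sum.elim (fun a => some (Sum.inl a))
      (Fin.snoc (α := fun _ => Option (α ⊕ Fin n)) (fun i => some (Sum.inr i)) none))).congr
      fun v => ?_
    have : (Fin.snoc (fun i => v (some (Sum.inr i))) (v none) : Fin (n + 1) → Finset I) =
        fun i => v (Fin.snoc (α := fun _ => Option (α ⊕ Fin n))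
          (fun i => some (Sum.inr i)) none i) := by
      ext i : 1
      refine Fin.lastCases ?_ (fun i => ?_) i <;> simp
    rw [this]
    rfl

end Recognizable

end Formulas

/-! ### Relations with a positive existential definition -/

section PositiveExistential

open FirstOrder Language

variable {α β : Type}

theorem _root_.IsPositiveExistential.relabel {L : Language} {γ : Type} {m n : ℕ}
    {φ : L.BoundedFormula α n} (h : IsPositiveExistential φ) (g : α → γ ⊕ Fin m) :
    IsPositiveExistential (φ.relabel g) := by
  induction h with
  | of_isAtomic h => exact .of_isAtomic (h.relabel g)
  | inf _ _ h₁ h₂ =>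
    -- `φ ⊓ ψ` and `φ ⊔ ψ` unfold to implications and negations, with which `relabel` commutes.
    simpa only [min, BoundedFormula.relabel_not, BoundedFormula.relabel_imp] using h₁.inf h₂
  | sup _ _ h₁ h₂ =>
    simpa only [max, BoundedFormula.relabel_not, BoundedFormula.relabel_imp] using h₁.sup h₂
  | ex _ h =>
    rw [BoundedFormula.relabel_ex]
    exact h.ex

theorem _root_.IsPositiveExistential.exs {L : Language} {n : ℕ} {φ : L.BoundedFormula α n}
    (h : IsPositiveExistential φ) : IsPositiveExistential φ.exs := by
  induction n with
  | zero => exact h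
  | succ n ih => exact ih h.ex

variable {I : Type*} [LinearOrder I] [OrderBot I]

/-- A function of finite subsets of `I` is a term function if some term defines it. -/
def IsTermFun (F : (α → Finset I) → Finset I) : Prop :=
  ∃ t : langWI.Term α, ∀ v, F v = t.realize v

/-- A relation between finite subsets of `I` is positive existential if some positive existential
formula defines it. -/
def PosEx (R : (α → Finset I) → Prop) : Prop :=
  ∃ ψ : langWI.Formula α, IsPositiveExistential ψ ∧ ∀ v, R v ↔ ψ.Realize v

namespace IsTermFun

theorem var (k : α) : IsTermFun fun v : α → Finset I => v k :=
  ⟨.var k, fun _ => rfl⟩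

theorem func {n : ℕ} (f : langWI.Functions n) {F : Fin n → (α → Finset I) → Finset I}
    (hF : ∀ i, IsTermFun (F i)) :
    IsTermFun fun v => Structure.funMap f fun i => F i v := by
  choose t ht using hF
  exact ⟨.func f t, fun v => by simp [ht]⟩

variable {F G : (α → Finset I) → Finset I}

theorem union (hF : IsTermFun F) (hG : IsTermFun G) : IsTermFun fun v => F v ∪ G v :=
  func WIFunc.union (F := ![F, G]) (Fin.forall_fin_two.2 ⟨hF, hG⟩)

theorem inter (hF : IsTermFun F) (hG : IsTermFun G) : IsTermFun fun v => F v ∩ G v :=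
  func WIFunc.inter (F := ![F, G]) (Fin.forall_fin_two.2 ⟨hF, hG⟩)

theorem ips (hF : IsTermFun F) (hG : IsTermFun G) : IsTermFun fun v => ips (F v) (G v) :=
  func WIFunc.ips (F := ![F, G]) (Fin.forall_fin_two.2 ⟨hF, hG⟩)

theorem maxSet (hF : IsTermFun F) : IsTermFun fun v => maxSet (F v) :=
  func WIFunc.max (F := ![F]) (Fin.forall_fin_one.2 hF)

theorem empty : IsTermFun fun _ : α → Finset I => ∅ :=
  func WIFunc.empty (F := ![]) (fun i => i.elim0)

theorem bot : IsTermFun fun _ : α → Finset I => {⊥} :=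
  func WIFunc.zero (F := ![]) (fun i => i.elim0)

theorem biUnion {ι : Type*} (s : Finset ι) {F : ι → (α → Finset I) → Finset I}
    (hF : ∀ i, IsTermFun (F i)) : IsTermFun fun v => s.biUnion fun i => F i v := by
  classical
  induction s using Finset.induction with
  | empty => simpa using empty
  | insert i s _ ih => simpa only [Finset.biUnion_insert] using (hF i).union ih

end IsTermFun

namespace PosEx

theorem eq {F G : (α → Finset I) → Finset I} (hF : IsTermFun F) (hG : IsTermFun G) :
    PosEx fun v => F v = G v := by
  obtain ⟨s, hs⟩ := hF
  obtain ⟨t, ht⟩ := hG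
  exact ⟨s.equal t, .of_isAtomic (.equal _ _), fun v => by simp [hs, ht]⟩

theorem subset {F G : (α → Finset I) → Finset I} (hF : IsTermFun F) (hG : IsTermFun G) :
    PosEx fun v => F v ⊆ G v := by
  simpa only [Finset.union_eq_right] using eq (hF.union hG) hG

theorem and {R S : (α → Finset I) → Prop} (hR : PosEx R) (hS : PosEx S) :
    PosEx fun v => R v ∧ S v := by
  obtain ⟨φ, hφ, hR⟩ := hR
  obtain ⟨ψ, hψ, hS⟩ := hS
  exact ⟨φ ⊓ ψ, hφ.inf hψ, fun v =>
    (and_congr (hR v) (hS v)).trans Formula.realize_inf.symm⟩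

theorem all_of_finite {ι : Type*} [Finite ι] {R : ι → (α → Finset I) → Prop}
    (hR : ∀ i, PosEx (R i)) : PosEx fun v => ∀ i, R i v := by
  classical
  have := Fintype.ofFinite ι
  suffices ∀ s : Finset ι, PosEx fun v => ∀ i ∈ s, R i v by simpa using this Finset.univ
  intro s
  induction s using Finset.induction with
  | empty => simpa using eq (I := I) (α := α) IsTermFun.empty IsTermFun.empty
  | insert i s _ ih => simpa only [Finset.forall_mem_insert] using (hR i).and ih

/-- The hypothesis `p` does not depend on the tuple, so this is `R` or a trivial relation. -/
theorem of_imp {p : Prop} {R : (α → Finset I) → Prop} (hR : PosEx R) : PosEx fun v => p → R v := by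
  by_cases hp : p
  · simpa [hp] using hR
  · simpa [hp] using eq (I := I) (α := α) IsTermFun.empty IsTermFun.empty

theorem ex [Finite β] {R : (α → Finset I) → (β → Finset I) → Prop}
    (hR : PosEx fun v : α ⊕ β → Finset I => R (fun a => v (.inl a)) (fun b => v (.inr b))) :
    PosEx fun v => ∃ P, R v P := by
  obtain ⟨ψ, hψ, hR⟩ := hR
  refine ⟨ψ.iExs β, (hψ.relabel _).exs, fun v => ?_⟩
  rw [Formula.realize_iExs]
  exact exists_congr fun P => hR (Sum.elim v P)

end PosEx

end PositiveExistential

/-! ### Accepting runs as tuples of finite sets -/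

section Runs

variable {I : Type*} [LinearOrder I] {α σ : Type}

open Classical in
/-- The set of the points whose color lies in `A`, for a coloring with color classes `P`. -/
noncomputable def colored {C : Type} [Fintype C] (P : C → Finset I) (A : Set C) : Finset I :=
  (Finset.univ.filter (· ∈ A)).biUnion P

@[simp] theorem mem_colored {C : Type} [Fintype C] {P : C → Finset I} {A : Set C} {x : I} :
    x ∈ colored P A ↔ ∃ c ∈ A, x ∈ P c := by
  simp [colored]

/-- The color classes `P` describe an accepting run of `M` on the word of `v` along their union:
the points of color `(q, a)` are those at which the automaton is in state `q` and reads the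
letter `a`. Every clause is a
finite conjunction of inclusions or equations between terms of the signature. -/
structure IsAcceptingRun [OrderBot I] [Fintype (σ × Set α)] (M : DFA (Set α) σ)
    (v : α → Finset I) (P : σ × Set α → Finset I) : Prop where
  disjoint : ∀ c d, c ≠ d → P c ∩ P d = ∅
  eq_colored : ∀ k, v k = colored P {c | k ∈ c.2}
  start : {⊥} ⊆ colored P {c | c.1 = M.start}
  step : ∀ c, P c ⊆ ips (colored P Set.univ) (colored P {d | d.1 = M.step c.1 c.2}) ∪
    maxSet (colored P Set.univ)
  accept : maxSet (colored P Set.univ) ⊆ colored P {c | M.step c.1 c.2 ∈ M.accept}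

variable [OrderBot I] [Fintype (σ × Set α)] {M : DFA (Set α) σ} {v : α → Finset I}
  {P : σ × Set α → Finset I}

theorem IsAcceptingRun.snd_eq_letter (h : IsAcceptingRun M v P) {c : σ × Set α} {x : I}
    (hx : x ∈ P c) : c.2 = letter v x := by
  ext k
  rw [mem_letter, h.eq_colored k, mem_colored]
  refine ⟨fun hk => ⟨c, hk, hx⟩, ?_⟩
  rintro ⟨d, hd, hxd⟩
  by_contra hk
  have hcd : c ≠ d := by
    rintro rfl
    exact hk hd
  simpa [h.disjoint c d hcd] using Finset.mem_inter.2 ⟨hx, hxd⟩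

theorem IsAcceptingRun.eq_of_mem (h : IsAcceptingRun M v P) {c d : σ × Set α} {x : I}
    (hc : x ∈ P c) (hd : x ∈ P d) : c = d := by
  by_contra hcd
  simpa [h.disjoint c d hcd] using Finset.mem_inter.2 ⟨hc, hd⟩

/-- A coloring in the sense of `IsAcceptingRun` really follows the automaton: from a point of color
`(q, a)` on, the run that starts in `q` is accepting. -/
theorem IsAcceptingRun.evalFrom_mem_accept (h : IsAcceptingRun M v P) {L : List I}
    (hL : L.Pairwise (· < ·)) (hmem : ∀ x, x ∈ L ↔ x ∈ colored P Set.univ) (t l : List I) (x : I)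
    (ht : L = l ++ x :: t) (c : σ × Set α) (hx : x ∈ P c) :
    M.evalFrom c.1 ((x :: t).map (letter v)) ∈ M.accept := by
  rw [List.map_cons, DFA.evalFrom_cons, ← h.snd_eq_letter hx]
  induction t generalizing l x c with
  | nil =>
    have hmax : x ∈ maxSet (colored P Set.univ) := by
      refine mem_maxSet.2 ⟨mem_colored.2 ⟨c, trivial, hx⟩, fun y hy => ?_⟩
      have hy := (hmem y).2 hy
      rw [ht, List.pairwise_append] at hL
      rw [ht, List.mem_append, List.mem_singleton] at hy
      exact hy.elim (fun hy => (hL.2.2 y hy x (by simp)).le) le_of_eq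
    obtain ⟨d, hd, hxd⟩ := mem_colored.1 (h.accept hmax)
    rwa [h.eq_of_mem hx hxd]
  | cons y t ih =>
    have hL' := hL
    rw [ht, List.pairwise_append, List.pairwise_cons, List.pairwise_cons] at hL'
    have hxy : x < y := hL'.2.1.1 y (by simp)
    rcases Finset.mem_union.1 (h.step c hx) with hs | hs
    · obtain ⟨z, hz, hxz⟩ := mem_ips.1 hs
      -- The enumeration is increasing, so the successor of `x` is the next entry of the list.
      have hzy : z = y := by
        refine (hxz.2.2.2 y ((hmem y).1 (by simp [ht])) hxy).antisymm ?_
        have hzL := (hmem z).2 hxz.2.1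
        rw [ht, List.mem_append, List.mem_cons, List.mem_cons] at hzL
        rcases hzL with hzl | rfl | rfl | hzt
        · exact absurd hxz.2.2.1 (hL'.2.2 z hzl x (by simp)).not_gt
        · exact absurd hxz.2.2.1 (lt_irrefl _)
        · exact le_rfl
        · exact (hL'.2.1.2.1 z hzt).le
      subst hzy
      obtain ⟨d, hd, hyd⟩ := mem_colored.1 hz
      have := ih (l ++ [x]) z (by simp [ht]) d hyd
      rwa [List.map_cons, DFA.evalFrom_cons, ← h.snd_eq_letter hyd, ← show d.1 = _ from hd]
    · exact absurd hxy ((mem_maxSet.1 hs).2 y ((hmem y).1 (by simp [ht]))).not_gt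

/-- The coloring assigns to each point the state reached just before it and the letter read. -/
theorem exists_isAcceptingRun {l : List I} (hl : Covers v l)
    (hacc : M.eval ((⊥ :: l).map (letter v)) ∈ M.accept) : ∃ P, IsAcceptingRun M v P := by
  classical
  generalize hL : ⊥ :: l = L at hacc
  have hsort : L.Pairwise (· < ·) := hL ▸ hl.sorted
  -- `st x` is the state of the automaton just before it reads the letter at `x`.
  set st : I → σ := fun x => M.eval ((L.filter (· < x)).map (letter v)) with hst
  have hst_append : ∀ l₁ x l₂, L = l₁ ++ x :: l₂ → st x = M.eval (l₁.map (letter v)) := by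
    intro l₁ x l₂ h
    rw [h, List.pairwise_append, List.pairwise_cons] at hsort
    have h₁ : l₁.filter (· < x) = l₁ :=
      List.filter_eq_self.2 fun y hy => decide_eq_true (hsort.2.2 y hy x (by simp))
    have h₂ : (x :: l₂).filter (· < x) = [] := by
      rw [List.filter_eq_nil_iff]
      intro y hy
      rcases List.mem_cons.1 hy with rfl | hy
      · simp
      · simpa using (hsort.2.1.1 y hy).le
    rw [hst]
    simp only [h, List.filter_append, h₁, h₂, List.append_nil]
  set P : σ × Set α → Finset I :=
    fun c => L.toFinset.filter fun x => st x = c.1 ∧ letter v x = c.2 with hP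
  have hmemP : ∀ {c x}, x ∈ P c ↔ x ∈ L ∧ (st x, letter v x) = c := by
    intro c x
    simp [hP, Prod.ext_iff]
  have hcol : ∀ {A : Set (σ × Set α)} {x}, x ∈ colored P A ↔ x ∈ L ∧ (st x, letter v x) ∈ A := by
    intro A x
    simp only [mem_colored, hmemP]
    exact ⟨fun ⟨c, hc, hx, h⟩ => ⟨hx, h ▸ hc⟩, fun ⟨hx, h⟩ => ⟨_, h, hx, rfl⟩⟩
  have hcol_univ : ∀ {x}, x ∈ colored P Set.univ ↔ x ∈ L := by simp [hcol]
  refine ⟨P, ?_, ?_, ?_, ?_, ?_⟩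
  · intro c d hcd
    rw [Finset.eq_empty_iff_forall_notMem]
    intro x hx
    rw [Finset.mem_inter, hmemP, hmemP] at hx
    exact hcd (hx.1.2.symm.trans hx.2.2)
  · intro k
    ext x
    rw [hcol]
    exact ⟨fun hx => ⟨hL ▸ hl.mem k x hx, hx⟩, fun hx => hx.2⟩
  · rw [Finset.singleton_subset_iff, hcol]
    exact ⟨by simp [← hL], hst_append [] ⊥ l hL.symm⟩
  · intro c x hx
    obtain ⟨hxL, rfl⟩ := hmemP.1 hx
    obtain ⟨l₁, l₂, h⟩ := List.append_of_mem hxL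
    have hs := hsort
    rw [h, List.pairwise_append, List.pairwise_cons] at hs
    rw [Finset.mem_union, mem_ips, mem_maxSet]
    cases l₂ with
    | nil =>
      refine Or.inr ⟨hcol_univ.2 hxL, fun y hy => ?_⟩
      have hy := hcol_univ.1 hy
      rw [h, List.mem_append, List.mem_singleton] at hy
      exact hy.elim (fun hy => (hs.2.2 y hy x (by simp)).le) le_of_eq
    | cons y l₂ =>
      have hyL : y ∈ L := by simp [h]
      rw [List.pairwise_cons] at hs
      refine Or.inl ⟨y, hcol.2 ⟨hyL, ?_⟩, hcol_univ.2 hxL, hcol_univ.2 hyL,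
        hs.2.1.1 y (by simp), fun k hk hxk => ?_⟩
      · have := hst_append (l₁ ++ [x]) y l₂ (by simp [h])
        rw [List.map_append, List.map_singleton, DFA.eval_append_singleton,
          ← hst_append l₁ x _ h] at this
        exact this
      · have hk := hcol_univ.1 hk
        rw [h, List.mem_append, List.mem_cons, List.mem_cons] at hk
        rcases hk with hk | rfl | rfl | hk
        · exact absurd hxk (hs.2.2 k hk x (by simp)).not_gt
        · exact absurd hxk (lt_irrefl _)
        · exact le_rfl
        · exact (hs.2.1.2.1 k hk).le
  · intro x hx
    rw [mem_maxSet, hcol_univ] at hx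
    obtain ⟨l₁, l₂, h⟩ := List.append_of_mem hx.1
    have hl₂ : l₂ = [] := by
      refine List.eq_nil_iff_forall_not_mem.2 fun y hy => ?_
      have hs := hsort
      rw [h, List.pairwise_append, List.pairwise_cons] at hs
      exact absurd (hs.2.1.1 y hy) (hx.2 y (hcol_univ.2 (by simp [h, hy]))).not_gt
    subst hl₂
    refine hcol.2 ⟨hx.1, ?_⟩
    rw [h, List.map_append, List.map_singleton, DFA.eval_append_singleton,
      ← hst_append l₁ x _ h] at hacc
    exact hacc

end Runs

/-- A recognizable relation says that an accepting run of its automaton exists, and a run is a tuple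
of finite sets subject to positive conditions. -/
theorem Recognizable.posEx {I : Type*} [LinearOrder I] [OrderBot I] {α : Type} [Finite α]
    {R : (α → Finset I) → Prop} (hR : Recognizable R) : PosEx R := by
  classical
  obtain ⟨_, ⟨σ, hσ, M, rfl⟩, hR⟩ := hR
  have := Fintype.ofFinite α
  have := Fintype.ofFinite (σ × Set α)
  have hrun : ∀ v, R v ↔ ∃ P, IsAcceptingRun M v P := by
    refine fun v => ⟨fun h => ?_, ?_⟩
    · obtain ⟨l, hl, -⟩ := Covers.exists v (Finset.univ.biUnion v)
        fun k => Finset.subset_biUnion_of_mem v (Finset.mem_univ k)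
      exact exists_isAcceptingRun hl ((hR v l hl).1 h)
    · rintro ⟨P, hP⟩
      obtain ⟨c, hc, hcP⟩ := mem_colored.1 (Finset.singleton_subset_iff.1 hP.start)
      obtain ⟨l, hl, hmem⟩ := Covers.exists v (colored P Set.univ) (by
        intro k x hx
        rw [hP.eq_colored k, mem_colored] at hx
        exact mem_colored.2 (hx.imp fun c hc => ⟨trivial, hc.2⟩))
      refine (hR v l hl).2 ?_
      have := hP.evalFrom_mem_accept hl.sorted (fun x => (hmem x).trans
        (or_iff_right_of_imp fun hx => hx ▸ mem_colored.2 ⟨c, trivial, hcP⟩)) l [] ⊥ rfl c hcP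
      rwa [show c.1 = M.start from hc] at this
  have hpos : ∀ c, IsTermFun fun w : α ⊕ (σ × Set α) → Finset I => w (.inr c) := fun c => .var _
  have hvar : ∀ k, IsTermFun fun w : α ⊕ (σ × Set α) → Finset I => w (.inl k) := fun k => .var _
  have hcol : ∀ A : Set (σ × Set α), IsTermFun
      fun w : α ⊕ (σ × Set α) → Finset I => colored (fun c => w (.inr c)) A :=
    fun A => .biUnion _ hpos
  rw [show R = _ from funext fun v => propext (hrun v)]
  refine PosEx.ex ?_
  have := (PosEx.all_of_finite fun c => .all_of_finite fun d => .of_imp (p := c ≠ d)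
    (.eq ((hpos c).inter (hpos d)) .empty)).and
    ((PosEx.all_of_finite fun k => .eq (hvar k) (hcol {c | k ∈ c.2})).and
    ((PosEx.subset .bot (hcol {c | c.1 = M.start})).and
    ((PosEx.all_of_finite fun c => .subset (hpos c)
      (((hcol Set.univ).ips (hcol {d | d.1 = M.step c.1 c.2})).union (hcol Set.univ).maxSet)).and
    (PosEx.subset (hcol Set.univ).maxSet (hcol {c | M.step c.1 c.2 ∈ M.accept})))))
  convert this using 2 with w
  exact ⟨fun h => ⟨h.1, h.2, h.3, h.4, h.5⟩,
    fun h => ⟨h.1, h.2.1, h.2.2.1, h.2.2.2.1, h.2.2.2.2⟩⟩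

end WI

theorem mainTheorem2 {I : Type*} [LinearOrder I] [DenselyOrdered I] [OrderBot I] [NoMaxOrder I] :
    PositiveModelComplete langWI (Finset I) := by
  intro n φ
  refine (((WI.Recognizable.boundedFormula φ).reindex
    (Sum.elim id Fin.elim0 : Fin n ⊕ Fin 0 → Fin n)).congr fun v => ?_).posEx
  exact iff_of_eq
    (congrArg (FirstOrder.Language.BoundedFormula.Realize φ v) (Subsingleton.elim _ _))
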